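/- Let $\mathcal H$ be a separable infinite-dimensional complex Hilbert space. A norming function is a norm $\Phi$ on the space of finitely supported real sequences $(\xi_j)_{j\in\mathbb N}$ that is invariant under permutations of $\mathbb N$ and satisfies $\Phi(1,0,0,\dots)=1$. For an operator $T$ of finite rank on $\mathcal H$ put $|T|_\Phi=\Phi((s_j)_j)$, where the $s_j$ are the eigenvalues of $(T^*T)^{1/2}$, repeated according to multiplicity; for a general bounded operator $T$ put $|T|_\Phi=\sup_P|TP|_\Phi\in[0,\infty]$, the supremum being over the finite rank hermitian projections $P$. For an $n$-tuple $\varphi=(\varphi(1),\dots,\varphi(n))$ of norming functions and an $n$-tuple $\tau=(\tau(1),\dots,\tau(n))$ of bounded operators on $\mathcal H$, the modulus of quasicentral approximation is $$k_\varphi(\tau)=\liminf_{A\in\mathcal R_1^+}\ \max_{1\le j\le n}\bigl|\tau(j)A-A\tau(j)\bigr|_{\varphi(j)}\in[0,\infty],$$ where $\mathcal R_1^+$ is the set of finite rank positive contractions on $\mathcal H$, directed by the usual order of hermitian operators. Let $p_1,\dots,p_n\in(1,\infty)$ satisfy $\sum_{j=1}^n 1/p_j=1$, and let $\varphi(j)=\Phi_{p_j}$,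 where $\Phi_p(\xi)=\bigl(\sum_j|\xi_j|^p\bigr)^{1/p}$ is the norming function of the Schatten class $\mathcal C_p$. Then $k_\varphi(\tau)=0$ for every $n$-tuple $\tau$ of commuting hermitian bounded operators on $\mathcal H$. -/

import Mathlib

open scoped InnerProductSpace

noncomputable section

/-- Symmetric norming functions on the space of finitely supported real sequences. -/
structure NormingFunction where
  toFun : (ℕ →₀ ℝ) → ℝ
  pos_of_ne_zero : ∀ ξ, ξ ≠ 0 → 0 < toFun ξ
  map_smul : ∀ (α : ℝ) (ξ : ℕ →₀ ℝ), toFun (α • ξ) = |α| * toFun ξ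
  add_le : ∀ ξ η : ℕ →₀ ℝ, toFun (ξ + η) ≤ toFun ξ + toFun η
  map_unit : toFun (Finsupp.single 0 1) = 1
  map_perm : ∀ (π : Equiv.Perm ℕ) (ξ : ℕ →₀ ℝ), toFun (ξ.equivMapDomain π) = toFun ξ

/-- The Schatten norming function `Φ_p(ξ) = (∑ |ξ_j|^p)^(1/p)`, for `1 ≤ p < ∞`. -/
def schattenNorming (p : ℝ) (hp : 1 ≤ p) : NormingFunction where
  toFun ξ := (∑ j ∈ ξ.support, |ξ j| ^ p) ^ (1 / p)
  pos_of_ne_zero ξ hξ := by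
    apply Real.rpow_pos_of_pos
    refine Finset.sum_pos (fun j hj => ?_) (Finsupp.support_nonempty_iff.2 hξ)
    exact Real.rpow_pos_of_pos (abs_pos.2 (Finsupp.mem_support_iff.1 hj)) _
  map_smul α ξ := by
    have hp0 : p ≠ 0 := by linarith
    have h0 : ∑ j ∈ (α • ξ).support, |(α • ξ) j| ^ p = ∑ j ∈ ξ.support, |(α • ξ) j| ^ p := by
      refine Finset.sum_subset Finsupp.support_smul (fun j _ hj => ?_)
      rw [Finsupp.notMem_support_iff.1 hj, abs_zero, Real.zero_rpow hp0]
    rw [h0]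
    simp only [Finsupp.smul_apply, smul_eq_mul, abs_mul]
    simp_rw [Real.mul_rpow (abs_nonneg α) (abs_nonneg _)]
    rw [← Finset.mul_sum, Real.mul_rpow (by positivity) (by positivity),
      ← Real.rpow_mul (abs_nonneg α), mul_one_div_cancel hp0, Real.rpow_one]
  add_le ξ η := by
    have hp0 : p ≠ 0 := by linarith
    classical
    have key : ∀ (ζ : ℕ →₀ ℝ), ζ.support ⊆ ξ.support ∪ η.support →
        ∑ j ∈ ζ.support, |ζ j| ^ p = ∑ j ∈ ξ.support ∪ η.support, |ζ j| ^ p := by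
      intro ζ hζ
      refine Finset.sum_subset hζ (fun j _ hj => ?_)
      rw [Finsupp.notMem_support_iff.1 hj, abs_zero, Real.zero_rpow hp0]
    rw [key _ Finsupp.support_add, key ξ Finset.subset_union_left,
      key η Finset.subset_union_right]
    exact Real.Lp_add_le _ (fun j => ξ j) (fun j => η j) hp
  map_unit := by
    rw [Finsupp.support_single _ one_ne_zero]
    simp
  map_perm π ξ := by
    congr 1
    simp [Finsupp.equivMapDomain]

section Operators

variable {H : Type*} [NormedAddCommGroup H] [InnerProductSpace ℂ H]

/-- Operators of finite rank. -/
def IsFiniteRank (T : H →L[ℂ] H) : Prop :=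
  FiniteDimensional ℂ (LinearMap.range T.toLinearMap)

/-- `T` viewed as a map from the orthogonal complement of its kernel onto its range. -/
def essentialPart (T : H →L[ℂ] H) :
    (LinearMap.ker T.toLinearMap)ᗮ →ₗ[ℂ] LinearMap.range T.toLinearMap :=
  T.toLinearMap.rangeRestrict ∘ₗ (LinearMap.ker T.toLinearMap)ᗮ.subtype

theorem essentialPart_injective (T : H →L[ℂ] H) : Function.Injective (essentialPart T) := by
  rw [← LinearMap.ker_eq_bot, LinearMap.ker_eq_bot']
  rintro ⟨x, hx⟩ h
  have h1 : T x = 0 := congrArg Subtype.val h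
  have h2 : x ∈ LinearMap.ker T.toLinearMap := h1
  have h3 : ⟪x, x⟫_ℂ = 0 := (Submodule.mem_orthogonal _ _).1 hx x h2
  exact Subtype.ext (inner_self_eq_zero.1 h3)

theorem IsFiniteRank.finiteDimensional_orthogonal {T : H →L[ℂ] H} (h : IsFiniteRank T) :
    FiniteDimensional ℂ (LinearMap.ker T.toLinearMap)ᗮ :=
  haveI : FiniteDimensional ℂ (LinearMap.range T.toLinearMap) := h
  FiniteDimensional.of_injective _ (essentialPart_injective T)

open Classical in
/-- The singular numbers of a finite rank operator `T`: the nonzero eigenvalues of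
`(T* T)^(1/2)`, in decreasing order and repeated according to multiplicity, followed by zeros.
On the kernel of `T` the operator `(T* T)^(1/2)` vanishes, so these are the singular values of the
finite-dimensional map `essentialPart T`. (The value is zero if `T` is not of finite rank.) -/
def singularNumbers (T : H →L[ℂ] H) : ℕ →₀ ℝ :=
  if h : IsFiniteRank T then
    haveI : FiniteDimensional ℂ (LinearMap.range T.toLinearMap) := h
    haveI := h.finiteDimensional_orthogonal
    (essentialPart T).singularValues
  else 0

variable [CompleteSpace H]

/-- Hermitian projections of finite rank. -/
def IsFiniteRankProj (P : H →L[ℂ] H) : Prop :=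
  IsStarProjection P ∧ IsFiniteRank P

open Classical in
/-- The norm `|T|_Φ`, with values in `[0, ∞]`: it is `Φ((s_j)_j)` if `T` is of finite rank with
singular numbers `s_j`, and `sup_P |TP|_Φ`, over all finite rank projections `P`, otherwise. -/
def idealNorm (Φ : NormingFunction) (T : H →L[ℂ] H) : ENNReal :=
  if IsFiniteRank T then ENNReal.ofReal (Φ.toFun (singularNumbers T))
  else ⨆ P : {P : H →L[ℂ] H // IsFiniteRankProj P},
    ENNReal.ofReal (Φ.toFun (singularNumbers (T * P.1)))

variable (H) in
/-- The positive contractions of finite rank, with the usual order of hermitian operators. -/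
abbrev FiniteRankPosContraction : Type _ :=
  {A : H →L[ℂ] H // IsFiniteRank A ∧ A.IsPositive ∧ ‖A‖ ≤ 1}

/-- `|τ|_φ = max_j |τ(j)|_{φ(j)}` for an `n`-tuple of operators. -/
def tupleNorm {n : ℕ} (φ : Fin n → NormingFunction) (τ : Fin n → H →L[ℂ] H) : ENNReal :=
  ⨆ j, idealNorm (φ j) (τ j)

/-- The commutators `[τ, X](j) = [τ(j), X]`. -/
def tupleCommutator {n : ℕ} (τ : Fin n → H →L[ℂ] H) (X : H →L[ℂ] H) : Fin n → H →L[ℂ] H :=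
  fun j => τ j * X - X * τ j

/-- The modulus of quasicentral approximation `k_φ(τ)`. -/
def quasicentralModulus {n : ℕ} (φ : Fin n → NormingFunction) (τ : Fin n → H →L[ℂ] H) : ENNReal :=
  Filter.liminf (fun A : FiniteRankPosContraction H => tupleNorm φ (tupleCommutator τ A.1))
    Filter.atTop

end Operators

end

/-! Above any finite-dimensional F there must be a finite rank positive contraction with small
commutators; such operators are cofinal, so the liminf vanishes. Put r_j = 2^(-1/p_j), so that ∏ r_j
= 1/2. At scale k, cut τ(j) into about r_j^(-k) spectral pieces. The joint pieces move F inside a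
space G_k of dimension O(2^k), whose projection commutes with the discretized τ(j); hence its
commutator with τ(j) has norm O(r_j^k) and rank O(2^k) (`exists_starProjection_dyadic`). Let A be
the average of the first m projections. By min-max, each dyadic block of singular numbers of ∑_k
[τ(j), P_k] contributes O(1) to the sum of p_j-th powers, because r_j^(p_j) 2 = 1
(`idealNorm_schatten_sum_le`). The Schatten norm of [τ(j), A] is thus O(m^(1/p_j) / m), which tends
to 0 since p_j > 1. -/

open scoped InnerProductSpace

noncomputable section

/-! ### Singular numbers and approximation by finite rank operators -/

section SingularValues

variable {𝕜 E F : Type*} [RCLike 𝕜] [NormedAddCommGroup E] [InnerProductSpace 𝕜 E]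
  [FiniteDimensional 𝕜 E] [NormedAddCommGroup F] [InnerProductSpace 𝕜 F] [FiniteDimensional 𝕜 F]

/-- One half of the min-max principle for singular values. -/
theorem LinearMap.singularValues_le_of_forall_ker {V : Type*} [AddCommGroup V] [Module 𝕜 V]
    (T : E →ₗ[𝕜] F) (Y : E →ₗ[𝕜] V) {i : ℕ} (hY : Module.finrank 𝕜 (LinearMap.range Y) ≤ i)
    {c : ℝ} (hc : 0 ≤ c) (h : ∀ x, Y x = 0 → ‖T x‖ ≤ c * ‖x‖) : T.singularValues i ≤ c := by
  rcases le_or_gt (Module.finrank 𝕜 E) i with hi | hi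
  · rw [T.singularValues_of_finrank_le hi]
    exact hc
  set hT := T.isSymmetric_adjoint_comp_self
  set b := hT.eigenvectorBasis rfl
  let ι : Fin (i + 1) → Fin (Module.finrank 𝕜 E) := Fin.castLE hi
  have hι : Function.Injective ι := Fin.castLE_injective hi
  have hon : Orthonormal 𝕜 (b ∘ ι) := b.orthonormal.comp ι hι
  let L : (Fin (i + 1) → 𝕜) →ₗ[𝕜] E := Fintype.linearCombination 𝕜 (b ∘ ι)
  -- The top i + 1 eigenvectors span more dimensions than the rank of Y, so Y kills a nonzero
  -- combination of them.
  have hker : LinearMap.ker (Y.rangeRestrict ∘ₗ L) ≠ ⊥ := by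
    apply LinearMap.ker_ne_bot_of_finrank_lt
    simpa using Nat.lt_succ_of_le hY
  obtain ⟨a, ha, ha0⟩ := Submodule.exists_mem_ne_zero_of_ne_bot hker
  have hYa : Y (L a) = 0 := congrArg Subtype.val (LinearMap.mem_ker.1 ha)
  have hLa : L a = ∑ j, a j • b (ι j) := by simp [L, Fintype.linearCombination_apply]
  have hnorm : ‖L a‖ ^ 2 = ∑ j, ‖a j‖ ^ 2 := by
    have := hon.inner_sum a a Finset.univ
    simp only [Function.comp_apply] at this
    rw [← hLa] at this
    rw [← inner_self_eq_norm_sq (𝕜 := 𝕜), this, map_sum]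
    refine Finset.sum_congr rfl fun j _ => ?_
    rw [RCLike.conj_mul]
    norm_cast
  have hsq : ‖T (L a)‖ ^ 2 = ∑ j, hT.eigenvalues rfl (ι j) * ‖a j‖ ^ 2 := by
    have h1 : (LinearMap.adjoint T ∘ₗ T) (L a)
        = ∑ j, ((hT.eigenvalues rfl (ι j) : 𝕜) * a j) • b (ι j) := by
      rw [hLa, map_sum]
      refine Finset.sum_congr rfl fun j _ => ?_
      rw [map_smul, hT.apply_eigenvectorBasis, smul_smul, mul_comm]
    have h2 : inner 𝕜 ((LinearMap.adjoint T ∘ₗ T) (L a)) (L a) = inner 𝕜 (T (L a)) (T (L a)) := by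
      rw [LinearMap.comp_apply, LinearMap.adjoint_inner_left]
    rw [← inner_self_eq_norm_sq (𝕜 := 𝕜), ← h2, h1]
    nth_rw 1 [hLa]
    have := hon.inner_sum (fun j => (hT.eigenvalues rfl (ι j) : 𝕜) * a j) a Finset.univ
    simp only [Function.comp_apply] at this
    rw [this, map_sum]
    refine Finset.sum_congr rfl fun j _ => ?_
    rw [map_mul (starRingEnd 𝕜), RCLike.conj_ofReal, mul_assoc, RCLike.conj_mul]
    norm_cast
  have hpos : 0 < ∑ j, ‖a j‖ ^ 2 := by
    obtain ⟨j, hj⟩ := Function.ne_iff.1 ha0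
    refine Finset.sum_pos' (fun _ _ => by positivity) ⟨j, Finset.mem_univ _, ?_⟩
    have : 0 < ‖a j‖ := norm_pos_iff.2 hj
    positivity
  have hlow : T.singularValues i ^ 2 * ∑ j, ‖a j‖ ^ 2 ≤ ‖T (L a)‖ ^ 2 := by
    rw [hsq, Finset.mul_sum, T.sq_singularValues_of_lt rfl hi]
    refine Finset.sum_le_sum fun j _ => mul_le_mul_of_nonneg_right ?_ (by positivity)
    exact hT.eigenvalues_antitone rfl (Nat.lt_succ_iff.1 j.2)
  have hup : ‖T (L a)‖ ^ 2 ≤ c ^ 2 * ∑ j, ‖a j‖ ^ 2 := by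
    rw [← hnorm, ← mul_pow]
    exact pow_le_pow_left₀ (norm_nonneg _) (h _ hYa) 2
  exact le_of_sq_le_sq (le_of_mul_le_mul_right (hlow.trans hup) hpos) hc

end SingularValues

section SingularNumbers

variable {H : Type*} [NormedAddCommGroup H] [InnerProductSpace ℂ H]

theorem singularNumbers_nonneg (X : H →L[ℂ] H) (i : ℕ) : 0 ≤ singularNumbers X i := by
  unfold singularNumbers
  split_ifs with h
  · have : FiniteDimensional ℂ (LinearMap.range X.toLinearMap) := h
    have := h.finiteDimensional_orthogonal
    exact LinearMap.singularValues_nonneg _ i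
  · simp

/-- On the kernel of Y, X agrees with X - Y, so min-max applies. -/
theorem singularNumbers_le_norm_sub (X Y : H →L[ℂ] H) {i : ℕ} (hY : IsFiniteRank Y)
    (hi : Module.finrank ℂ (LinearMap.range Y.toLinearMap) ≤ i) :
    singularNumbers X i ≤ ‖X - Y‖ := by
  unfold singularNumbers
  split_ifs with h
  · have : FiniteDimensional ℂ (LinearMap.range X.toLinearMap) := h
    have : FiniteDimensional ℂ (LinearMap.range Y.toLinearMap) := hY
    have := h.finiteDimensional_orthogonal
    refine LinearMap.singularValues_le_of_forall_ker (essentialPart X)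
      (Y.toLinearMap ∘ₗ (LinearMap.ker X.toLinearMap)ᗮ.subtype)
      ((Submodule.finrank_mono (LinearMap.range_comp_le_range _ _)).trans hi) (norm_nonneg _) ?_
    intro x hx
    have h1 : Y x = 0 := hx
    have h2 : ‖essentialPart X x‖ = ‖(X - Y) x‖ := by
      rw [sub_apply, h1, sub_zero]
      rfl
    rw [h2]
    exact (X - Y).le_opNorm x
  · simp

end SingularNumbers

/-! ### Schatten norms of dyadic sums -/

/-- The block from R 2^k to R 2^(k+1) has R 2^k terms, each at most K^p 2^(-k), so it contributes R
K^p whatever k is. The indices below R give one more such block. -/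
theorem sum_rpow_le_of_dyadic_decay {p : ℝ} (hp : 0 < p) {r : ℝ} (hr0 : 0 ≤ r)
    (hr : r ^ p = 1 / 2) {K : ℝ} (hK : 0 ≤ K) (R : ℕ) {s : ℕ → ℝ} (hs : ∀ i, 0 ≤ s i)
    (m : ℕ) (h : ∀ k ≤ m, ∀ i, R * 2 ^ k ≤ i → s i ≤ K * r ^ k)
    (h0 : ∀ i, s i ≤ K) :
    ∑ i ∈ Finset.range (R * 2 ^ m), s i ^ p ≤ (m + 1) * R * K ^ p := by
  induction m with
  | zero =>
    calc ∑ i ∈ Finset.range (R * 2 ^ 0), s i ^ p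
        ≤ ∑ i ∈ Finset.range (R * 2 ^ 0), K ^ p :=
          Finset.sum_le_sum fun i _ => Real.rpow_le_rpow (hs i) (h0 i) hp.le
      _ = _ := by simp
  | succ m ih =>
    have ih := ih fun k hk => h k (hk.trans m.le_succ)
    have hle : R * 2 ^ m ≤ R * 2 ^ (m + 1) := by gcongr <;> simp
    rw [← Finset.sum_range_add_sum_Ico _ hle]
    have h2 : ∑ i ∈ Finset.Ico (R * 2 ^ m) (R * 2 ^ (m + 1)), s i ^ p ≤ R * K ^ p := by
      calc ∑ i ∈ Finset.Ico (R * 2 ^ m) (R * 2 ^ (m + 1)), s i ^ p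
          ≤ ∑ i ∈ Finset.Ico (R * 2 ^ m) (R * 2 ^ (m + 1)), K ^ p * (1 / 2) ^ m := by
            refine Finset.sum_le_sum fun i hi => ?_
            refine (Real.rpow_le_rpow (hs i) (h m m.le_succ i (Finset.mem_Ico.1 hi).1) hp.le).trans
              (le_of_eq ?_)
            rw [Real.mul_rpow hK (by positivity), ← hr, ← Real.rpow_natCast, ← Real.rpow_natCast,
              ← Real.rpow_mul hr0, ← Real.rpow_mul hr0, mul_comm p]
        _ = R * K ^ p := by
            have : R * 2 ^ (m + 1) - R * 2 ^ m = R * 2 ^ m := by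
              rw [pow_succ, ← mul_assoc]
              omega
            rw [Finset.sum_const, Nat.card_Ico, this, nsmul_eq_mul]
            push_cast
            rw [one_div, inv_pow]
            field_simp
    push_cast
    linarith


section FiniteRank

variable {H : Type*} [NormedAddCommGroup H] [InnerProductSpace ℂ H]

theorem IsFiniteRank.of_range_le {X : H →L[ℂ] H} {G : Submodule ℂ H} [FiniteDimensional ℂ G]
    (h : LinearMap.range X.toLinearMap ≤ G) : IsFiniteRank X :=
  Submodule.finiteDimensional_of_le h

theorem IsFiniteRank.add {X Y : H →L[ℂ] H} (hX : IsFiniteRank X) (hY : IsFiniteRank Y) :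
    IsFiniteRank (X + Y) ∧ Module.finrank ℂ (LinearMap.range (X + Y).toLinearMap) ≤
      Module.finrank ℂ (LinearMap.range X.toLinearMap) +
        Module.finrank ℂ (LinearMap.range Y.toLinearMap) := by
  have : FiniteDimensional ℂ (LinearMap.range X.toLinearMap) := hX
  have : FiniteDimensional ℂ (LinearMap.range Y.toLinearMap) := hY
  have hle : LinearMap.range (X + Y).toLinearMap ≤
      LinearMap.range X.toLinearMap ⊔ LinearMap.range Y.toLinearMap := by
    rintro _ ⟨x, rfl⟩
    exact Submodule.add_mem_sup ⟨x, rfl⟩ ⟨x, rfl⟩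
  exact ⟨IsFiniteRank.of_range_le hle,
    (Submodule.finrank_mono hle).trans (Submodule.finrank_add_le_finrank_add_finrank _ _)⟩

theorem isFiniteRank_zero : IsFiniteRank (0 : H →L[ℂ] H) := by
  refine IsFiniteRank.of_range_le (G := ⊥) ?_
  rintro _ ⟨x, rfl⟩
  simp

theorem isFiniteRank_sum_range {X : ℕ → H →L[ℂ] H} (hX : ∀ k, IsFiniteRank (X k)) {R : ℕ}
    (hR : ∀ k, Module.finrank ℂ (LinearMap.range (X k).toLinearMap) ≤ R * 2 ^ k) (m : ℕ) :
    IsFiniteRank (∑ k ∈ Finset.range m, X k) ∧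
      Module.finrank ℂ (LinearMap.range (∑ k ∈ Finset.range m, X k).toLinearMap) ≤ R * 2 ^ m := by
  induction m with
  | zero =>
    rw [Finset.sum_range_zero]
    refine ⟨isFiniteRank_zero, ?_⟩
    have : LinearMap.range (0 : H →L[ℂ] H).toLinearMap = ⊥ := by
      rw [ContinuousLinearMap.toLinearMap_zero, LinearMap.range_zero]
    rw [this, finrank_bot]
    exact Nat.zero_le _
  | succ m ih =>
    rw [Finset.sum_range_succ]
    have h := IsFiniteRank.add ih.1 (hX m)
    refine ⟨h.1, h.2.trans ?_⟩
    rw [pow_succ, ← mul_assoc, mul_two]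
    exact add_le_add ih.2 (hR m)

end FiniteRank

/-- Stopping the sum at k leaves an operator of rank at most R 2^k and a geometric tail of norm at
most K r^k, which gives the dyadic decay of the singular numbers. -/
theorem idealNorm_schatten_sum_le {H : Type*} [NormedAddCommGroup H] [InnerProductSpace ℂ H]
    [CompleteSpace H] {p : ℝ} (hp : 1 ≤ p) {r : ℝ} (hr0 : 0 ≤ r) (hr1 : r < 1)
    (hr : r ^ p = 1 / 2) {X : ℕ → H →L[ℂ] H} (hX : ∀ k, IsFiniteRank (X k)) {R : ℕ}
    (hR : ∀ k, Module.finrank ℂ (LinearMap.range (X k).toLinearMap) ≤ R * 2 ^ k)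
    {L : ℝ} (hL : 0 ≤ L) (hXL : ∀ k, ‖X k‖ ≤ L * r ^ k) (m : ℕ) :
    idealNorm (schattenNorming p hp) (∑ k ∈ Finset.range m, X k) ≤
      ENNReal.ofReal (((m + 1) * R) ^ (1 / p) * (L / (1 - r))) := by
  have hp0 : 0 < p := by linarith
  have h1r : 0 < 1 - r := by linarith
  set K : ℝ := L / (1 - r)
  have hK : 0 ≤ K := by positivity
  set S := ∑ k ∈ Finset.range m, X k
  have hfin := isFiniteRank_sum_range hX hR
  have key : ∀ k ≤ m, ∀ i, R * 2 ^ k ≤ i → singularNumbers S i ≤ K * r ^ k := by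
    intro k hk i hi
    refine (singularNumbers_le_norm_sub S (∑ l ∈ Finset.range k, X l) (hfin k).1
      ((hfin k).2.trans hi)).trans ?_
    have hS : S - ∑ l ∈ Finset.range k, X l = ∑ l ∈ Finset.Ico k m, X l := by
      rw [Finset.sum_Ico_eq_sub _ hk]
    rw [hS]
    calc ‖∑ l ∈ Finset.Ico k m, X l‖ ≤ ∑ l ∈ Finset.Ico k m, L * r ^ l :=
          norm_sum_le_of_le _ fun l _ => hXL l
      _ = L * ∑ l ∈ Finset.Ico k m, r ^ l := by rw [Finset.mul_sum]
      _ ≤ L * (r ^ k / (1 - r)) :=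
          mul_le_mul_of_nonneg_left (geom_sum_Ico_le_of_lt_one hr0 hr1) hL
      _ = K * r ^ k := by simp only [K]; ring
  have h0 : ∀ i, singularNumbers S i ≤ K := by
    intro i
    refine (singularNumbers_le_norm_sub S (∑ l ∈ Finset.range 0, X l) (by
      simpa using isFiniteRank_zero) ?_).trans ?_
    · rw [Finset.sum_range_zero, ContinuousLinearMap.toLinearMap_zero, LinearMap.range_zero,
        finrank_bot]
      exact Nat.zero_le _
    · rw [Finset.sum_range_zero, sub_zero]
      calc ‖S‖ ≤ ∑ l ∈ Finset.range m, L * r ^ l := norm_sum_le_of_le _ fun l _ => hXL l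
        _ = L * ∑ l ∈ Finset.Ico 0 m, r ^ l := by rw [Finset.mul_sum, Finset.range_eq_Ico]
        _ ≤ L * (r ^ 0 / (1 - r)) :=
          mul_le_mul_of_nonneg_left (geom_sum_Ico_le_of_lt_one hr0 hr1) hL
        _ = K := by simp only [K]; ring
  have hvan : ∀ i, R * 2 ^ m ≤ i → singularNumbers S i = 0 := by
    intro i hi
    refine le_antisymm ?_ (singularNumbers_nonneg S i)
    refine (singularNumbers_le_norm_sub S S (hfin m).1 ((hfin m).2.trans hi)).trans ?_
    simp
  have hsum := sum_rpow_le_of_dyadic_decay hp0 hr0 hr hK R (singularNumbers_nonneg S) m key h0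
  have hsupp : ∑ i ∈ (singularNumbers S).support, |singularNumbers S i| ^ p ≤
      (m + 1) * R * K ^ p := by
    refine le_trans ?_ hsum
    simp only [abs_of_nonneg (singularNumbers_nonneg S _)]
    refine Finset.sum_le_sum_of_subset_of_nonneg ?_ fun i _ _ =>
      Real.rpow_nonneg (singularNumbers_nonneg S i) _
    intro i hi
    rw [Finset.mem_range]
    by_contra hcon
    exact Finsupp.mem_support_iff.1 hi (hvan i (not_lt.1 hcon))
  rw [idealNorm, if_pos (hfin m).1]
  refine ENNReal.ofReal_le_ofReal ?_
  calc (∑ i ∈ (singularNumbers S).support, |singularNumbers S i| ^ p) ^ (1 / p)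
      ≤ ((m + 1) * R * K ^ p) ^ (1 / p) :=
        Real.rpow_le_rpow (Finset.sum_nonneg fun i _ => by positivity) hsupp (by positivity)
    _ = ((m + 1) * R) ^ (1 / p) * K := by
        rw [Real.mul_rpow (by positivity) (by positivity), ← Real.rpow_mul hK,
          mul_one_div_cancel hp0.ne', Real.rpow_one]

/-! ### Spectral projections and discretization of a hermitian operator -/

section SpectralProjections

variable {H : Type*} [NormedAddCommGroup H] [InnerProductSpace ℂ H] [CompleteSpace H]

/-- Invariance means PSP = SP; taking adjoints gives PS = SP. -/
theorem IsSelfAdjoint.commute_starProjection {S : H →L[ℂ] H} (hS : IsSelfAdjoint S)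
    (K : Submodule ℂ H) [K.HasOrthogonalProjection] (h : ∀ x ∈ K, S x ∈ K) :
    Commute S K.starProjection := by
  have h1 : K.starProjection * (S * K.starProjection) = S * K.starProjection := by
    ext x
    exact Submodule.starProjection_eq_self_iff.2 (h _ (Submodule.starProjection_apply_mem K x))
  have h2 := congrArg star h1
  have hP : star K.starProjection = K.starProjection :=
    (isStarProjection_starProjection (U := K)).isSelfAdjoint
  rw [star_mul, star_mul, hP, hS.star_eq, mul_assoc, h1] at h2
  exact h2

/-- The witness is the spectral projection of (0, ∞): the complement of the projection onto ker T⁺.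
Since T⁺T⁻ = 0, it splits T into T⁺ and -T⁻; an S commuting with T commutes with T⁺ and so preserves
its kernel. -/
theorem IsSelfAdjoint.exists_isStarProjection_mul_nonneg {T : H →L[ℂ] H} (hT : IsSelfAdjoint T) :
    ∃ e : H →L[ℂ] H, IsStarProjection e ∧ (∀ S, IsSelfAdjoint S → Commute S T → Commute S e) ∧
      0 ≤ T * e ∧ T * (1 - e) ≤ 0 := by
  let K := LinearMap.ker (T⁺).toLinearMap
  have hKc : IsClosed (K : Set H) := (T⁺).isClosed_ker
  have : CompleteSpace K := hKc.completeSpace_coe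
  have hq : IsStarProjection K.starProjection := isStarProjection_starProjection
  have hpq : T⁺ * K.starProjection = 0 := by
    ext x
    exact LinearMap.mem_ker.1 (Submodule.starProjection_apply_mem K x)
  have hqn : K.starProjection * T⁻ = T⁻ := by
    ext x
    refine Submodule.starProjection_eq_self_iff.2 (LinearMap.mem_ker.2 ?_)
    exact congrArg (fun A : H →L[ℂ] H => A x) (CFC.posPart_mul_negPart T)
  have hnq : T⁻ * K.starProjection = T⁻ := by
    have h := congrArg star hqn
    rwa [star_mul, hq.isSelfAdjoint.star_eq, (CFC.negPart_nonneg T).isSelfAdjoint.star_eq] at h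
  have hTq : T * K.starProjection = -T⁻ := by
    conv_lhs => rw [← CFC.posPart_sub_negPart T hT]
    rw [sub_mul, hpq, hnq, zero_sub]
  refine ⟨1 - K.starProjection, hq.one_sub, fun S hS hST => ?_, ?_, ?_⟩
  · refine (Commute.one_right S).sub_right (hS.commute_starProjection K fun x hx => ?_)
    have hc : Commute T⁺ S := Commute.cfcₙ_real hST.symm _
    refine LinearMap.mem_ker.2 ?_
    have h1 : T⁺ (S x) = S (T⁺ x) := congrArg (fun A : H →L[ℂ] H => A x) hc.eq
    have h2 : T⁺ x = 0 := hx
    exact h1.trans (by rw [h2, map_zero])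
  · rw [mul_sub, mul_one, hTq]
    have : T - -T⁻ = T⁺ := by
      conv_lhs => enter [1]; rw [← CFC.posPart_sub_negPart T hT]
      abel
    rw [this]
    exact CFC.posPart_nonneg T
  · rw [sub_sub_cancel, hTq]
    exact neg_nonpos.2 (CFC.negPart_nonneg T)

/-- A general Q, on which a ≤ T ≤ a + (N + 1)δ, lets the induction peel off one interval of length δ
at a time. The commutation clause later makes the pieces of different τ(j) commute. -/
theorem IsSelfAdjoint.exists_spectral_partition {T : H →L[ℂ] H} (hT : IsSelfAdjoint T) {δ : ℝ}
    (N : ℕ) (a : ℝ) (Q : H →L[ℂ] H) (hQ : IsStarProjection Q)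
    (hQc : ∀ S, IsSelfAdjoint S → Commute S T → Commute S Q)
    (hlow : 0 ≤ T * Q - a • Q) (hup : 0 ≤ (a + (N + 1) * δ) • Q - T * Q) :
    ∃ (E : Fin (N + 1) → H →L[ℂ] H) (c : Fin (N + 1) → ℝ), (∀ i, IsStarProjection (E i)) ∧
      (∀ i S, IsSelfAdjoint S → Commute S T → Commute S (E i)) ∧
      (∀ i j, i ≠ j → E i * E j = 0) ∧ ∑ i, E i = Q ∧
      0 ≤ T * Q - ∑ i, c i • E i ∧ 0 ≤ δ • Q - (T * Q - ∑ i, c i • E i) := by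
  induction N generalizing a Q with
  | zero =>
    refine ⟨fun _ => Q, fun _ => a, fun _ => hQ, fun _ => hQc, fun i j hij => ?_, by simp, ?_, ?_⟩
    · exact absurd (Subsingleton.elim (α := Fin 1) i j) hij
    · simpa using hlow
    · convert hup using 1
      simp [add_smul]
      abel
  | succ N ih =>
    have hT' : IsSelfAdjoint (T - (a + δ) • (1 : H →L[ℂ] H)) :=
      hT.sub (IsSelfAdjoint.smul (IsSelfAdjoint.all (a + δ)) (IsSelfAdjoint.one _))
    obtain ⟨e, he, hec, hpos, hneg⟩ := hT'.exists_isStarProjection_mul_nonneg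
    have hec' : ∀ S, IsSelfAdjoint S → Commute S T → Commute S e := fun S hS hST =>
      hec S hS (hST.sub_right ((Commute.one_right S).smul_right _))
    have hTe : Commute T e := hec' T hT (Commute.refl T)
    have hTQ : Commute T Q := hQc T hT (Commute.refl T)
    have hQe : Commute Q e := hec' Q hQ.isSelfAdjoint hTQ.symm
    have hf : IsStarProjection (1 - e) := he.one_sub
    have hQf : Commute Q (1 - e) := (Commute.one_right Q).sub_right hQe
    have hTf : Commute T (1 - e) := (Commute.one_right T).sub_right hTe
    have hxQ : ∀ x : ℝ, Commute (T * Q - x • Q) e := fun x =>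
      (hTe.mul_left hQe).sub_left (hQe.smul_left x)
    have hQx : ∀ x : ℝ, Commute (x • Q - T * Q) e := fun x =>
      (hQe.smul_left x).sub_left (hTe.mul_left hQe)
    obtain ⟨E, c, hE, hEc, hEo, hEs, hE1, hE2⟩ := ih (a + δ) (Q * e)
      (hQ.mul he hQe) (fun S hS hST => (hQc S hS hST).mul_right (hec' S hS hST))
      (by
        have := Commute.mul_nonneg hpos hQ.nonneg
          ((hTQ.sub_left ((Commute.one_left Q).smul_left _)).mul_left hQe.symm)
        convert this using 1
        rw [mul_assoc, ← hQe.eq, sub_mul, smul_mul_assoc, one_mul])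
      (by
        have := Commute.mul_nonneg hup he.nonneg (hQx _)
        convert this using 1
        rw [sub_mul, smul_mul_assoc, mul_assoc]
        push_cast
        ring_nf)
    have hfe : (1 - e) * e = 0 := by rw [sub_mul, one_mul, he.isIdempotentElem.eq, sub_self]
    have hEQ : ∀ i, Q * e * E i = E i := by
      intro i
      rw [← hEs, Finset.sum_mul, Finset.sum_eq_single i (fun j _ hj => hEo j i hj) (by simp),
        (hE i).isIdempotentElem.eq]
    have hE0 : ∀ i, Q * (1 - e) * E i = 0 := by
      intro i
      rw [← hEQ i, ← mul_assoc, hQe.eq, ← mul_assoc, mul_assoc Q, hfe, mul_zero, zero_mul, zero_mul]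
    have hf0 : IsStarProjection (Q * (1 - e)) := hQ.mul hf hQf
    have h0E : ∀ i, E i * (Q * (1 - e)) = 0 := by
      intro i
      have := congrArg star (hE0 i)
      rwa [star_mul, hf0.isSelfAdjoint.star_eq, (hE i).isSelfAdjoint.star_eq, star_zero] at this
    have hlow0 : 0 ≤ T * (Q * (1 - e)) - a • (Q * (1 - e)) := by
      have := Commute.mul_nonneg hlow hf.nonneg ((Commute.one_right _).sub_right (hxQ a))
      convert this using 1
      rw [sub_mul, smul_mul_assoc, mul_assoc]
    have hup0 : 0 ≤ δ • (Q * (1 - e)) - (T * (Q * (1 - e)) - a • (Q * (1 - e))) := by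
      have := Commute.mul_nonneg (neg_nonneg.2 hneg) hQ.nonneg
        ((hTQ.sub_left ((Commute.one_left Q).smul_left _)).mul_left hQf.symm).neg_left
      convert this using 1
      rw [neg_mul, mul_assoc, ← hQf.eq, sub_mul, smul_mul_assoc, one_mul, add_smul]
      abel
    have hsplit : Q = Q * (1 - e) + Q * e := by rw [← mul_add, sub_add_cancel, mul_one]
    have hdiff : T * Q - (a • (Q * (1 - e)) + ∑ i, c i • E i) =
        (T * (Q * (1 - e)) - a • (Q * (1 - e))) + (T * (Q * e) - ∑ i, c i • E i) := by
      nth_rw 1 [hsplit]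
      rw [mul_add]
      abel
    -- The new piece is the part of Q where T ≤ a + δ, given the left endpoint a as its value.
    refine ⟨Fin.cons (Q * (1 - e)) E, Fin.cons a c, ?_, ?_, ?_, ?_, ?_, ?_⟩
    · exact Fin.cases hf0 hE
    · refine Fin.cases (fun S hS hST => ?_) hEc
      exact (hQc S hS hST).mul_right ((Commute.one_right S).sub_right (hec' S hS hST))
    · refine Fin.cases (Fin.cases (fun h => absurd rfl h) fun j _ => ?_) fun i =>
        Fin.cases (fun _ => ?_) fun j hij => ?_
      · simpa using hE0 j
      · simpa using h0E i
      · simpa using hEo i j fun h => hij (by rw [h])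
    · rw [Fin.sum_univ_succ]
      simp only [Fin.cons_zero, Fin.cons_succ]
      rw [hEs, ← hsplit]
    · rw [Fin.sum_univ_succ]
      simp only [Fin.cons_zero, Fin.cons_succ]
      rw [hdiff]
      exact add_nonneg hlow0 hE1
    · rw [Fin.sum_univ_succ]
      simp only [Fin.cons_zero, Fin.cons_succ]
      rw [hdiff]
      have := add_nonneg hup0 hE2
      convert this using 1
      nth_rw 1 [hsplit]
      rw [smul_add]
      abel

theorem IsSelfAdjoint.exists_discretization {T : H →L[ℂ] H} (hT : IsSelfAdjoint T) (N : ℕ) :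
    ∃ (E : Fin (N + 1) → H →L[ℂ] H) (c : Fin (N + 1) → ℝ), (∀ i, IsStarProjection (E i)) ∧
      (∀ i S, IsSelfAdjoint S → Commute S T → Commute S (E i)) ∧
      (∀ i j, i ≠ j → E i * E j = 0) ∧ ∑ i, E i = 1 ∧
      ‖T - ∑ i, c i • E i‖ ≤ 2 * ‖T‖ / (N + 1) := by
  obtain ⟨E, c, hE, hEc, hEo, hEs, h1, h2⟩ := hT.exists_spectral_partition
    (δ := 2 * ‖T‖ / (N + 1)) N (-‖T‖) 1 (IsStarProjection.one _)
    (fun S _ _ => Commute.one_right S)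
    (by
      have := hT.neg_algebraMap_norm_le_self
      rw [mul_one, neg_smul, ← Algebra.algebraMap_eq_smul_one]
      exact sub_nonneg.2 this)
    (by
      have := hT.le_algebraMap_norm_self
      have h : -‖T‖ + ((N : ℝ) + 1) * (2 * ‖T‖ / (N + 1)) = ‖T‖ := by
        field_simp
        ring
      rw [h, mul_one, ← Algebra.algebraMap_eq_smul_one]
      exact sub_nonneg.2 this)
  refine ⟨E, c, hE, hEc, hEo, hEs, ?_⟩
  rw [mul_one] at h1 h2
  rw [CStarAlgebra.norm_le_iff_le_algebraMap _ (by positivity) h1,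
    Algebra.algebraMap_eq_smul_one]
  exact sub_nonneg.1 h2

end SpectralProjections

/-! ### Finite-dimensional subspaces almost invariant under the tuple -/

section InvariantSubspaces

variable {H : Type*} [NormedAddCommGroup H] [InnerProductSpace ℂ H]

/-- Replace G by ∑_i E_{j₀,i} G, one coordinate j₀ at a time. It contains G because the pieces sum
to 1, keeps the earlier invariance because they commute, and multiplies the dimension by at most N
j₀. -/
theorem exists_invariant_submodule {ι : Type*} (s : Finset ι) {N : ι → ℕ}
    (E : ∀ j, Fin (N j) → H →L[ℂ] H) (hE : ∀ j i, IsIdempotentElem (E j i))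
    (hEo : ∀ j i i', i ≠ i' → E j i * E j i' = 0) (hEs : ∀ j, ∑ i, E j i = 1)
    (hEc : ∀ j j' i i', Commute (E j i) (E j' i'))
    (F : Submodule ℂ H) [FiniteDimensional ℂ F] :
    ∃ G : Submodule ℂ H, FiniteDimensional ℂ G ∧ F ≤ G ∧
      Module.finrank ℂ G ≤ Module.finrank ℂ F * ∏ j ∈ s, N j ∧
      ∀ j ∈ s, ∀ i, ∀ g ∈ G, E j i g ∈ G := by
  classical
  induction s using Finset.induction_on with
  | empty => exact ⟨F, inferInstance, le_rfl, by simp, by simp⟩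
  | insert j₀ s hj₀ ih =>
    obtain ⟨G, hG, hFG, hdim, hinv⟩ := ih
    let L : (Fin (N j₀) → G) →ₗ[ℂ] H :=
      ∑ i, ((E j₀ i).toLinearMap ∘ₗ G.subtype) ∘ₗ LinearMap.proj i
    have hL : ∀ g, L g = ∑ i, E j₀ i (g i : H) := by
      intro g
      simp [L]
    have hone : ∀ x : H, ∑ i, E j₀ i x = x := by
      intro x
      rw [← sum_apply, hEs j₀]
      rfl
    refine ⟨LinearMap.range L, inferInstance, ?_, ?_, ?_⟩
    · intro x hx
      exact ⟨fun _ => ⟨x, hFG hx⟩, by rw [hL]; exact hone x⟩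
    · refine (LinearMap.finrank_range_le L).trans ?_
      rw [Module.finrank_pi_fintype, Finset.sum_const, Finset.card_univ, Fintype.card_fin,
        smul_eq_mul, Finset.prod_insert hj₀, mul_left_comm]
      exact Nat.mul_le_mul_left _ hdim
    · intro j hj i x hx
      obtain ⟨g, rfl⟩ := hx
      rw [hL, map_sum]
      rcases Finset.mem_insert.1 hj with rfl | hj
      · refine ⟨Pi.single i (g i), ?_⟩
        rw [hL, Finset.sum_eq_single i, Finset.sum_eq_single i]
        · rw [Pi.single_eq_same]
          exact (congrArg (fun A : H →L[ℂ] H => A (g i)) (hE j i).eq).symm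
        · intro i' _ hi'
          exact congrArg (fun A : H →L[ℂ] H => A (g i')) (hEo j i i' hi'.symm)
        · simp
        · intro i' _ hi'
          simp [hi']
        · simp
      · refine ⟨fun i' => ⟨E j i (g i'), hinv j hj i _ (g i').2⟩, ?_⟩
        rw [hL]
        exact Finset.sum_congr rfl fun i' _ =>
          congrArg (fun A : H →L[ℂ] H => A (g i')) (hEc j₀ j i' i).eq

theorem finrank_range_commutator_starProjection_le (T : H →L[ℂ] H) (G : Submodule ℂ H)
    [FiniteDimensional ℂ G] :
    IsFiniteRank (T * G.starProjection - G.starProjection * T) ∧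
      Module.finrank ℂ
        (LinearMap.range (T * G.starProjection - G.starProjection * T).toLinearMap) ≤
      2 * Module.finrank ℂ G := by
  have hle : LinearMap.range (T * G.starProjection - G.starProjection * T).toLinearMap ≤
      G.map T.toLinearMap ⊔ G := by
    rintro _ ⟨x, rfl⟩
    exact Submodule.sub_mem_sup
      (Submodule.mem_map_of_mem (Submodule.starProjection_apply_mem G x))
      (Submodule.starProjection_apply_mem G (T x))
  refine ⟨IsFiniteRank.of_range_le hle, (Submodule.finrank_mono hle).trans
    ((Submodule.finrank_add_le_finrank_add_finrank _ _).trans ?_)⟩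
  rw [two_mul]
  exact add_le_add_left (Submodule.finrank_map_le _ _) _

variable [CompleteSpace H]

/-- The projection onto G commutes with the step approximant D of τ(j), so only τ(j) - D enters the
commutator. -/
theorem exists_almost_commuting_starProjection {n : ℕ} (τ : Fin n → H →L[ℂ] H)
    (hherm : ∀ j, IsSelfAdjoint (τ j)) (hcomm : ∀ i j, Commute (τ i) (τ j)) (N : Fin n → ℕ)
    (F : Submodule ℂ H) [FiniteDimensional ℂ F] :
    ∃ G : Submodule ℂ H, ∃ _ : FiniteDimensional ℂ G, F ≤ G ∧
      Module.finrank ℂ G ≤ Module.finrank ℂ F * ∏ j, (N j + 1) ∧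
      ∀ j, ‖τ j * G.starProjection - G.starProjection * τ j‖ ≤ 4 * ‖τ j‖ / (N j + 1) := by
  choose E c hE hEc hEo hEs hD using fun j => (hherm j).exists_discretization (N j)
  have hτE : ∀ j j' i, Commute (τ j') (E j i) := fun j j' i =>
    hEc j i (τ j') (hherm j') (hcomm j' j)
  obtain ⟨G, hG, hFG, hdim, hinv⟩ := exists_invariant_submodule Finset.univ E
    (fun j i => (hE j i).isIdempotentElem) hEo hEs
    (fun j j' i i' => hEc j' i' (E j i) (hE j i).isSelfAdjoint (hτE j j' i).symm) F
  refine ⟨G, hG, hFG, hdim, fun j => ?_⟩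
  set D := ∑ i, c j i • E j i
  have hcD : Commute D G.starProjection := by
    refine Commute.sum_left _ _ _ fun i _ => Commute.smul_left ?_ _
    exact (hE j i).isSelfAdjoint.commute_starProjection G (hinv j (Finset.mem_univ j) i)
  have heq : τ j * G.starProjection - G.starProjection * τ j =
      (τ j - D) * G.starProjection - G.starProjection * (τ j - D) := by
    rw [sub_mul, mul_sub, hcD.eq]
    abel
  have hP : ‖G.starProjection‖ ≤ 1 := Submodule.starProjection_norm_le G
  rw [heq]
  calc ‖(τ j - D) * G.starProjection - G.starProjection * (τ j - D)‖
      ≤ ‖τ j - D‖ * ‖G.starProjection‖ + ‖G.starProjection‖ * ‖τ j - D‖ :=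
        (norm_sub_le _ _).trans (add_le_add (norm_mul_le _ _) (norm_mul_le _ _))
    _ ≤ ‖τ j - D‖ * 1 + 1 * ‖τ j - D‖ := by gcongr
    _ = 2 * ‖τ j - D‖ := by ring
    _ ≤ 2 * (2 * ‖τ j‖ / (N j + 1)) := by
        gcongr
        exact hD j
    _ = _ := by ring

end InvariantSubspaces

/-! ### Averaging projections over dyadic scales -/

section QuasicentralApproximation

variable {H : Type*} [NormedAddCommGroup H] [InnerProductSpace ℂ H] [CompleteSpace H]

/-- Projections that almost commute with `τ` at the scale `2 ^ (-k / p j)` in the `j`-th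
coordinate, of rank `O(2 ^ k)`. -/
theorem exists_starProjection_dyadic {n : ℕ} (τ : Fin n → H →L[ℂ] H)
    (hherm : ∀ j, IsSelfAdjoint (τ j)) (hcomm : ∀ i j, Commute (τ i) (τ j))
    (r : Fin n → ℝ) (hr0 : ∀ j, 0 < r j) (hr1 : ∀ j, r j < 1) (hr : ∏ j, r j = 1 / 2)
    (F : Submodule ℂ H) [FiniteDimensional ℂ F] (k : ℕ) :
    ∃ G : Submodule ℂ H, ∃ _ : FiniteDimensional ℂ G, F ≤ G ∧
      Module.finrank ℂ G ≤ Module.finrank ℂ F * 2 ^ n * 2 ^ k ∧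
      ∀ j, ‖τ j * G.starProjection - G.starProjection * τ j‖ ≤ 4 * ‖τ j‖ * r j ^ k := by
  obtain ⟨G, hG, hFG, hdim, hτ⟩ := exists_almost_commuting_starProjection τ hherm hcomm
    -- The number of pieces, floor + 1, lies between r_j^(-k) and 2 r_j^(-k); the product of the
    -- upper bounds is 2^n 2^k.
    (fun j => ⌊(r j ^ k)⁻¹⌋₊) F
  refine ⟨G, hG, hFG, hdim.trans ?_, fun j => (hτ j).trans ?_⟩
  · rw [mul_assoc]
    refine Nat.mul_le_mul_left _ ?_
    have h : ∏ j, ((⌊(r j ^ k)⁻¹⌋₊ : ℝ) + 1) ≤ ∏ j, (2 * (r j ^ k)⁻¹) := by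
      refine Finset.prod_le_prod (fun j _ => by positivity) fun j _ => ?_
      have h1 : (1 : ℝ) ≤ (r j ^ k)⁻¹ :=
        (one_le_inv₀ (pow_pos (hr0 j) k)).2 (pow_le_one₀ (hr0 j).le (hr1 j).le)
      have h2 := Nat.floor_le (zero_le_one.trans h1)
      linarith
    rw [Finset.prod_mul_distrib, Finset.prod_const, Finset.card_univ, Fintype.card_fin,
      Finset.prod_inv_distrib, Finset.prod_pow, hr, one_div, inv_pow, inv_inv] at h
    exact_mod_cast h
  · rw [div_eq_mul_inv]
    refine mul_le_mul_of_nonneg_left ?_ (by positivity)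
    rw [inv_le_comm₀ (by positivity) (pow_pos (hr0 j) k)]
    exact (Nat.lt_floor_add_one _).le

theorem tendsto_rpow_succ_mul_div {p : ℝ} (hp : 1 < p) (R C : ℝ) (hR : 0 ≤ R) (hC : 0 ≤ C) :
    Filter.Tendsto (fun m : ℕ => (((m : ℝ) + 1) * R) ^ (1 / p) * (C / m)) Filter.atTop
      (nhds 0) := by
  have hp0 : 0 < p := by linarith
  have hq : 0 < 1 - 1 / p := by
    rw [sub_pos, div_lt_one hp0]
    exact hp
  have h1 : Filter.Tendsto (fun m : ℕ => (2 * R) ^ (1 / p) * C * (m : ℝ) ^ (-(1 - 1 / p)))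
      Filter.atTop (nhds 0) := by
    have := ((tendsto_rpow_neg_atTop hq).comp tendsto_natCast_atTop_atTop).const_mul
      ((2 * R) ^ (1 / p) * C)
    rwa [mul_zero] at this
  refine tendsto_of_tendsto_of_tendsto_of_le_of_le' tendsto_const_nhds h1
    (Filter.Eventually.of_forall fun m => by positivity) ?_
  filter_upwards [Filter.eventually_ge_atTop 1] with m hm
  have hm1 : (1 : ℝ) ≤ m := by exact_mod_cast hm
  have hm0 : (0 : ℝ) < m := by linarith
  calc (((m : ℝ) + 1) * R) ^ (1 / p) * (C / m) ≤ (2 * R * m) ^ (1 / p) * (C / m) := by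
        refine mul_le_mul_of_nonneg_right (Real.rpow_le_rpow (by positivity) ?_ (by positivity))
          (by positivity)
        nlinarith
    _ = (2 * R) ^ (1 / p) * C * (m : ℝ) ^ (-(1 - 1 / p)) := by
        rw [Real.mul_rpow (by positivity) hm0.le, neg_sub, Real.rpow_sub hm0, Real.rpow_one]
        ring

theorem exists_quasicentral_contraction {n : ℕ} (p : Fin n → ℝ) (hp : ∀ j, 1 < p j)
    (hsum : ∑ j, (p j)⁻¹ = 1) (τ : Fin n → H →L[ℂ] H) (hherm : ∀ j, IsSelfAdjoint (τ j))
    (hcomm : ∀ i j, Commute (τ i) (τ j)) (F : Submodule ℂ H) [FiniteDimensional ℂ F]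
    {ε : ℝ} (hε : 0 < ε) :
    ∃ A : FiniteRankPosContraction H, F.starProjection ≤ A.1 ∧
      tupleNorm (fun j => schattenNorming (p j) (hp j).le) (tupleCommutator τ A.1) ≤
        ENNReal.ofReal ε := by
  -- This choice gives both r_j^(p_j) = 1/2 and, as ∑ 1/p_j = 1, ∏ r_j = 1/2.
  set r : Fin n → ℝ := fun j => (1 / 2) ^ (p j)⁻¹
  have hp0 : ∀ j, 0 < p j := fun j => zero_lt_one.trans (hp j)
  have hr0 : ∀ j, 0 < r j := fun j => Real.rpow_pos_of_pos (by norm_num) _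
  have hr1 : ∀ j, r j < 1 := fun j =>
    Real.rpow_lt_one (by norm_num) (by norm_num) (inv_pos.2 (hp0 j))
  have hrp : ∀ j, r j ^ p j = 1 / 2 := fun j => Real.rpow_inv_rpow (by norm_num) (hp0 j).ne'
  have hr : ∏ j, r j = 1 / 2 := by
    rw [← Real.rpow_sum_of_pos (by norm_num), hsum, Real.rpow_one]
  choose G hG hFG hdim hτ using exists_starProjection_dyadic τ hherm hcomm r hr0 hr1 hr F
  -- The factor 2 is there because a commutator with the projection onto G has range in TG + G.
  set R : ℕ := 2 * (Module.finrank ℂ F * 2 ^ n)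
  have hev : ∀ᶠ m : ℕ in Filter.atTop, 1 ≤ m ∧ ∀ j,
      (((m : ℝ) + 1) * R) ^ (1 / p j) * (4 * ‖τ j‖ / (1 - r j) / m) ≤ ε := by
    refine (Filter.eventually_ge_atTop 1).and (Filter.eventually_all.2 fun j => ?_)
    have h1 : 0 < 1 - r j := sub_pos.2 (hr1 j)
    exact ((tendsto_rpow_succ_mul_div (hp j) R (4 * ‖τ j‖ / (1 - r j)) (by positivity)
      (by positivity)).eventually_lt_const hε).mono fun m hm => hm.le
  obtain ⟨m, hm, hbound⟩ := hev.exists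
  have hm0 : (0 : ℝ) < m := by exact_mod_cast hm
  have hminv : 0 ≤ (m : ℝ)⁻¹ := by positivity
  set A : H →L[ℂ] H := ∑ k ∈ Finset.range m, (m : ℝ)⁻¹ • (G k).starProjection
  have hconst : ∀ B : H →L[ℂ] H, ∑ _k ∈ Finset.range m, (m : ℝ)⁻¹ • B = B := by
    intro B
    rw [Finset.sum_const, Finset.card_range, ← Nat.cast_smul_eq_nsmul ℝ, smul_smul,
      mul_inv_cancel₀ hm0.ne', one_smul]
  have hA0 : 0 ≤ A := Finset.sum_nonneg fun k _ => smul_nonneg hminv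
    (isStarProjection_starProjection (U := G k)).nonneg
  have hA1 : A ≤ 1 := by
    rw [← hconst 1]
    exact Finset.sum_le_sum fun k _ => smul_le_smul_of_nonneg_left
      (isStarProjection_starProjection (U := G k)).le_one hminv
  have hFA : F.starProjection ≤ A := by
    rw [← hconst F.starProjection]
    exact Finset.sum_le_sum fun k _ => smul_le_smul_of_nonneg_left
      (Submodule.starProjection_le_starProjection_iff.2 (hFG k)) hminv
  have hAfin : IsFiniteRank A := by
    have hle : LinearMap.range A.toLinearMap ≤ ⨆ k : Fin m, G k := by
      rintro _ ⟨x, rfl⟩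
      rw [ContinuousLinearMap.coe_coe, sum_apply]
      refine Submodule.sum_mem _ fun k hk => ?_
      refine Submodule.mem_iSup_of_mem ⟨k, Finset.mem_range.1 hk⟩ ?_
      rw [← Complex.coe_smul]
      exact Submodule.smul_mem _ _ (Submodule.starProjection_apply_mem (G k) x)
    exact IsFiniteRank.of_range_le hle
  refine ⟨⟨A, hAfin, (ContinuousLinearMap.nonneg_iff_isPositive A).1 hA0,
    (CStarAlgebra.norm_le_one_iff_of_nonneg A hA0).2 hA1⟩, hFA, iSup_le fun j => ?_⟩
  -- The weight 1/m is absorbed into τ(j), so that each term is itself a commutator with a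
  -- projection.
  let X : ℕ → H →L[ℂ] H := fun k =>
    ((m : ℝ)⁻¹ • τ j) * (G k).starProjection - (G k).starProjection * ((m : ℝ)⁻¹ • τ j)
  have hX : tupleCommutator τ A j = ∑ k ∈ Finset.range m, X k := by
    simp only [tupleCommutator, A, X, Finset.mul_sum, Finset.sum_mul, Finset.sum_sub_distrib,
      smul_mul_assoc, mul_smul_comm]
  have hXR := fun k => finrank_range_commutator_starProjection_le ((m : ℝ)⁻¹ • τ j) (G k)
  have h1 : 0 < 1 - r j := sub_pos.2 (hr1 j)
  change idealNorm _ (tupleCommutator τ A j) ≤ _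
  rw [hX]
  refine (idealNorm_schatten_sum_le (hp j).le (hr0 j).le (hr1 j) (hrp j) (fun k => (hXR k).1)
    (R := R) (fun k => (hXR k).2.trans ?_) (L := 4 * ‖τ j‖ / m) (by positivity)
    (fun k => ?_) m).trans (ENNReal.ofReal_le_ofReal ?_)
  · rw [mul_assoc 2]
    exact Nat.mul_le_mul_left 2 (hdim k)
  · have : X k = (m : ℝ)⁻¹ •
        (τ j * (G k).starProjection - (G k).starProjection * τ j) := by
      simp only [X, smul_mul_assoc, mul_smul_comm, smul_sub]
    change ‖X k‖ ≤ _
    rw [this, norm_smul, Real.norm_of_nonneg hminv]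
    calc (m : ℝ)⁻¹ * _ ≤ (m : ℝ)⁻¹ * (4 * ‖τ j‖ * r j ^ k) :=
          mul_le_mul_of_nonneg_left (hτ k j) hminv
      _ = _ := by ring
  · rw [div_right_comm]
    exact hbound j

/-- With P the projection onto F, A = PAP ≤ P1P = P. Hence dominating P suffices to dominate A. -/
theorem FiniteRankPosContraction.le_starProjection (A : FiniteRankPosContraction H)
    (F : Submodule ℂ H) [FiniteDimensional ℂ F] (h : LinearMap.range A.1.toLinearMap ≤ F) :
    A.1 ≤ F.starProjection := by
  have hP : IsStarProjection F.starProjection := isStarProjection_starProjection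
  have hA0 : 0 ≤ A.1 := (ContinuousLinearMap.nonneg_iff_isPositive A.1).2 A.2.2.1
  have hA1 : A.1 ≤ 1 := (CStarAlgebra.norm_le_one_iff_of_nonneg A.1 hA0).1 A.2.2.2
  have h1 : F.starProjection * A.1 = A.1 := by
    ext x
    exact Submodule.starProjection_eq_self_iff.2 (h ⟨x, rfl⟩)
  have h2 : A.1 * F.starProjection = A.1 := by
    have := congrArg star h1
    rwa [star_mul, hP.isSelfAdjoint.star_eq, hA0.isSelfAdjoint.star_eq] at this
  have h3 := hP.isSelfAdjoint.conjugate_nonneg (sub_nonneg.2 hA1)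
  rw [mul_sub, sub_mul, h1, h2, mul_one, hP.isIdempotentElem.eq] at h3
  exact sub_nonneg.1 h3

end QuasicentralApproximation

end

theorem mainTheorem7 {H : Type*} [NormedAddCommGroup H] [InnerProductSpace ℂ H] [CompleteSpace H]
    [TopologicalSpace.SeparableSpace H] (hH : ¬ FiniteDimensional ℂ H)
    {n : ℕ} (p : Fin n → ℝ) (hp : ∀ j, 1 < p j) (hsum : ∑ j, (p j)⁻¹ = 1)
    (τ : Fin n → H →L[ℂ] H) (hherm : ∀ j, IsSelfAdjoint (τ j))
    (hcomm : ∀ i j, Commute (τ i) (τ j)) :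
    quasicentralModulus (fun j => schattenNorming (p j) (hp j).le) τ = 0 := by
  have key := fun (F : Submodule ℂ H) [FiniteDimensional ℂ F] (ε : ℝ) (hε : 0 < ε) =>
    exists_quasicentral_contraction p hp hsum τ hherm hcomm F hε
  have : Nonempty (FiniteRankPosContraction H) := ⟨(key ⊥ 1 one_pos).choose⟩
  -- Directedness turns "frequently along `atTop`" into "cofinally", so small values above every A
  -- bound the liminf.
  have : IsDirectedOrder (FiniteRankPosContraction H) := by
    refine ⟨fun A B => ?_⟩
    have : FiniteDimensional ℂ (LinearMap.range A.1.toLinearMap) := A.2.1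
    have : FiniteDimensional ℂ (LinearMap.range B.1.toLinearMap) := B.2.1
    obtain ⟨C, hC, -⟩ :=
      key (LinearMap.range A.1.toLinearMap ⊔ LinearMap.range B.1.toLinearMap) 1 one_pos
    exact ⟨C, (A.le_starProjection _ le_sup_left).trans hC,
      (B.le_starProjection _ le_sup_right).trans hC⟩
  rw [← nonpos_iff_eq_zero]
  refine ENNReal.le_of_forall_pos_le_add fun ε hε _ => ?_
  rw [zero_add, ← ENNReal.ofReal_coe_nnreal]
  refine Filter.liminf_le_of_frequently_le (Filter.frequently_atTop.2 fun A => ?_)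
  have : FiniteDimensional ℂ (LinearMap.range A.1.toLinearMap) := A.2.1
  obtain ⟨C, hC, hnorm⟩ := key (LinearMap.range A.1.toLinearMap) ε hε
  exact ⟨C, (A.le_starProjection _ le_rfl).trans hC, hnorm⟩
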